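/- Let $m,n\ge 1$, let $A,B\in\mathbb{R}^{m\times n}$, let $\mathbf r=(r_1,\dots,r_m)\in\mathbb{R}^m$ and $\mathbf j=(j_1,\dots,j_n)\in\mathbb{R}^n$ be weight vectors (no ordering or sign condition on their entries is needed), and let $r_{\mathrm{ave}},j_{\mathrm{ave}}\in\mathbb{R}$. In the constrained bimatrix game $\mathcal G=(A,B,\mathbf r,\mathbf j,r_{\mathrm{ave}},j_{\mathrm{ave}})$ the feasible mixed strategies of players one and two are the elements of $$\widehat{\mathbf X}=\Big\{\mathbf x\in\mathbb{R}^m : x_i\ge 0 \text{ for all } i,\ \sum_{i=1}^m x_i=1,\ \mathbf r^T\mathbf x\le r_{\mathrm{ave}}\Big\},\qquad \widehat{\mathbf Y}=\Big\{\mathbf y\in\mathbb{R}^n : y_k\ge 0 \text{ for all } k,\ \sum_{k=1}^n y_k=1,\ \mathbf j^T\mathbf y\le j_{\mathrm{ave}}\Big\},$$ and their expected payoffs are $\mathbf x^TA\,\mathbf y$ and $\mathbf x^TB\,\mathbf y$, respectively. A Nash equilibrium of $\mathcal G$ is a pair $(\mathbf x^*,\mathbf y^*)\in\widehat{\mathbf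 X}\times\widehat{\mathbf Y}$ such that $\mathbf x^TA\,\mathbf y^*\le {\mathbf x^*}^TA\,\mathbf y^*$ for all $\mathbf x\in\widehat{\mathbf X}$ and ${\mathbf x^*}^TB\,\mathbf y\le {\mathbf x^*}^TB\,\mathbf y^*$ for all $\mathbf y\in\widehat{\mathbf Y}$. If $r_{\mathrm{ave}}\ge\min_{1\le i\le m} r_i$ and $j_{\mathrm{ave}}\ge\min_{1\le k\le n} j_k$, then $\mathcal G$ has a Nash equilibrium. -/

import Mathlib

open scoped Matrix

/-- The constrained bimatrix game `(A, B, r, j, rAve, jAve)` with `m` rows and `n` columns: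
`A` and `B` are the payoff matrices of players one and two, `r` and `j` the weight vectors,
`rAve` and `jAve` the bounds on the average weights. Weights are arbitrary real numbers. -/
structure ConstrainedBimatrixGame (m n : ℕ) where
  A : Matrix (Fin m) (Fin n) ℝ
  B : Matrix (Fin m) (Fin n) ℝ
  r : Fin m → ℝ
  j : Fin n → ℝ
  rAve : ℝ
  jAve : ℝ

namespace ConstrainedBimatrixGame

variable {m n : ℕ} (G : ConstrainedBimatrixGame m n)

/-- Feasible mixed strategies of player one: probability vectors `x` with `rᵀ x ≤ rAve`. -/
def rowStrategies : Set (Fin m → ℝ) :=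
  {x | x ∈ stdSimplex ℝ (Fin m) ∧ G.r ⬝ᵥ x ≤ G.rAve}

/-- Feasible mixed strategies of player two: probability vectors `y` with `jᵀ y ≤ jAve`. -/
def colStrategies : Set (Fin n → ℝ) :=
  {y | y ∈ stdSimplex ℝ (Fin n) ∧ G.j ⬝ᵥ y ≤ G.jAve}

/-- Expected payoff `xᵀ A y` of player one. -/
def rowPayoff (x : Fin m → ℝ) (y : Fin n → ℝ) : ℝ := x ⬝ᵥ (G.A *ᵥ y)

/-- Expected payoff `xᵀ B y` of player two. -/
def colPayoff (x : Fin m → ℝ) (y : Fin n → ℝ) : ℝ := x ⬝ᵥ (G.B *ᵥ y)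

/-- `(x, y)` is a Nash equilibrium: both strategies are feasible, and each maximizes the payoff
of its player over all feasible strategies of that player, the other strategy being fixed. -/
def IsNashEquilibrium (x : Fin m → ℝ) (y : Fin n → ℝ) : Prop :=
  x ∈ G.rowStrategies ∧ y ∈ G.colStrategies ∧
    (∀ x' ∈ G.rowStrategies, G.rowPayoff x' y ≤ G.rowPayoff x y) ∧
    (∀ y' ∈ G.colStrategies, G.colPayoff x y' ≤ G.colPayoff x y)

end ConstrainedBimatrixGame

/-! Payoffs are bilinear, so an equilibrium is a solution on the compact convex set of feasible
pairs of the variational inequality for the field `(A y, xᵀ B)` (`exists_variational_inequality`).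
Such a solution is a fixed point of `z ↦ P (z + Φ z)`, `P` the metric projection, and Brouwer's
theorem supplies one.

Brouwer is proved by volume. A nonvanishing `C¹` field equal to the identity on a sphere normalizes
to a map `f` of the ball into the sphere, with singular derivative. For `g = f - id` and small `t >
0`, `id + t g` maps the ball bijectively onto itself, so `∫ det (1 + t Dg)` is the volume of the
ball. The integrand is polynomial in `t`, so its integral at `t = 1` is still the volume, yet `det
Df = 0`. -/

/-! ### Jacobian determinants of perturbations of the identity -/

open MeasureTheory Polynomial in
/-- Extrapolation to `1` of polynomials of degree at most `d` from nodes in `(0, δ)`. -/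
theorem exists_extrapolation_weights (d : ℕ) {δ : ℝ} (hδ : 0 < δ) :
    ∃ v c : ℕ → ℝ, (∀ i ∈ Finset.range (d + 1), v i ∈ Set.Ioo 0 δ) ∧
      ∀ p : ℝ[X], p.natDegree ≤ d →
        p.eval 1 = ∑ i ∈ Finset.range (d + 1), c i * p.eval (v i) := by
  -- The shift by 2 keeps even the node `i = 0` strictly below `δ`.
  set v : ℕ → ℝ := fun i => δ / (i + 2) with hv
  refine ⟨v, fun i => (Lagrange.basis (Finset.range (d + 1)) v i).eval 1, ?_, ?_⟩
  · intro i _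
    have hi : (0 : ℝ) ≤ i := Nat.cast_nonneg i
    refine ⟨by positivity, ?_⟩
    exact div_lt_self hδ (by linarith)
  · intro p hp
    have hinj : Set.InjOn v (Finset.range (d + 1)) := by
      intro i _ k _ h
      have hi : (0 : ℝ) < (i : ℝ) + 2 := by positivity
      have hk : (0 : ℝ) < (k : ℝ) + 2 := by positivity
      simp only [hv] at h
      rw [div_eq_div_iff hi.ne' hk.ne'] at h
      have := mul_left_cancel₀ hδ.ne' h
      have h2 : (i : ℝ) = k := by linarith
      exact_mod_cast h2
    have hdeg : p.degree < (Finset.range (d + 1)).card := by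
      rw [Finset.card_range]
      exact (degree_le_of_natDegree_le hp).trans_lt (by exact_mod_cast Nat.lt_succ_self d)
    conv_lhs => rw [Lagrange.eq_interpolate hinj hdeg, Lagrange.interpolate_apply]
    simp [eval_finsetSum, mul_comm]

open Polynomial in
/-- `det (1 + t M)` is a polynomial in `t` of degree at most the dimension. -/
theorem ContinuousLinearMap.exists_polynomial_eval_eq_det_one_add_smul {E : Type*}
    [NormedAddCommGroup E] [NormedSpace ℝ E] [FiniteDimensional ℝ E] (M : E →L[ℝ] E) :
    ∃ p : ℝ[X], p.natDegree ≤ Module.finrank ℝ E ∧ ∀ t : ℝ, p.eval t = (1 + t • M).det := by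
  set b := Module.finBasis ℝ E
  set A := LinearMap.toMatrix b b (M : E →ₗ[ℝ] E) with hA
  refine ⟨Matrix.det ((X : ℝ[X]) • A.map C + (1 : Matrix _ _ ℝ).map C), ?_, fun t => ?_⟩
  · simpa using natDegree_det_X_add_C_le A 1
  · rw [← coe_evalRingHom, RingHom.map_det]
    change _ = LinearMap.det ((1 + t • M : E →L[ℝ] E) : E →ₗ[ℝ] E)
    rw [← LinearMap.det_toMatrix b]
    have h : LinearMap.toMatrix b b ((1 + t • M : E →L[ℝ] E) : E →ₗ[ℝ] E) = 1 + t • A := by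
      rw [ContinuousLinearMap.toLinearMap_add, ContinuousLinearMap.toLinearMap_smul, map_add,
        map_smul]
      exact congrArg (· + t • A) (LinearMap.toMatrix_one b)
    rw [h]
    clear_value A
    congr 1
    ext i k
    simp only [RingHom.mapMatrix_apply, Matrix.map_apply, Matrix.add_apply, Matrix.smul_apply,
      coe_evalRingHom, smul_eq_mul, eval_add, eval_mul, eval_X, eval_C]
    ring

/-- A perturbation of the identity by a contraction is bijective. -/
theorem bijective_add_of_contracting {E : Type*} [NormedAddCommGroup E] [CompleteSpace E]
    {g : E → E} {K : NNReal}
    (hg : ContractingWith K g) : Function.Bijective fun x => x + g x := by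
  constructor
  · intro x y h
    by_contra hne
    have h1 : ‖x - y‖ ≤ K * ‖x - y‖ := by
      have h2 := hg.2.dist_le_mul y x
      rw [dist_eq_norm, dist_eq_norm, norm_sub_rev y x] at h2
      have h3 : x - y = g y - g x := by
        have h4 : x + g x = y + g y := h
        rw [sub_eq_sub_iff_add_eq_add, h4, add_comm]
      rwa [← h3] at h2
    have h5 : 0 < ‖x - y‖ := norm_pos_iff.2 (sub_ne_zero.2 hne)
    have h6 : (K : ℝ) < 1 := by exact_mod_cast hg.1
    nlinarith
  · intro y
    have hc : ContractingWith K fun x => y - g x :=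
      ⟨hg.1, LipschitzWith.of_dist_le_mul fun a b => by
        rw [dist_sub_left]
        exact hg.2.dist_le_mul a b⟩
    refine ⟨ContractingWith.fixedPoint _ hc, ?_⟩
    have h := hc.fixedPoint_isFixedPt
    change y - g _ = _ at h
    exact (sub_eq_iff_eq_add.1 h).symm

/-- A bijection that fixes the complement of `U` pointwise maps `U` onto itself. -/
theorem Function.Bijective.image_eq_of_eqOn_compl {α : Type*} {f : α → α}
    (hf : Function.Bijective f) {U : Set α} (h : ∀ x ∉ U, f x = x) : f '' U = U := by
  have h1 : f '' Uᶜ = Uᶜ := by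
    ext y
    constructor
    · rintro ⟨x, hx, rfl⟩
      rwa [h x hx]
    · exact fun hy => ⟨y, hy, h y hy⟩
  have h2 := Set.image_compl_eq hf (s := U)
  rw [h1] at h2
  exact (compl_injective h2).symm

open MeasureTheory in
/-- If `g` is Lipschitz, vanishes off a bounded nonempty open set `U` and is differentiable on `U`,
then the Jacobian of `x ↦ x + g x` does not vanish identically on `U`. -/
theorem exists_det_one_add_fderiv_ne_zero {E : Type*} [NormedAddCommGroup E]
    [NormedSpace ℝ E] [FiniteDimensional ℝ E] {g : E → E} {K : NNReal}
    {U : Set E} (hU : IsOpen U) (hne : U.Nonempty) (hbdd : Bornology.IsBounded U)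
    (hg : LipschitzWith K g) (hg0 : ∀ x ∉ U, g x = 0) (hdiff : ∀ x ∈ U, DifferentiableAt ℝ g x) :
    ∃ x ∈ U, (1 + fderiv ℝ g x).det ≠ 0 := by
  let : MeasurableSpace E := borel E
  have : BorelSpace E := ⟨rfl⟩
  set μ : Measure E := Measure.addHaar
  by_contra! hzero
  have hcont : Continuous fun L : E →L[ℝ] E => L.det := ContinuousLinearMap.continuous_det
  obtain ⟨ε, hε, hdet⟩ : ∃ ε > 0, ∀ L : E →L[ℝ] E, ‖L‖ < ε → 0 < (1 + L).det := by
    have h1 : Filter.Tendsto (fun L : E →L[ℝ] E => (1 + L).det) (nhds 0) (nhds 1) := by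
      have h2 : Continuous fun L : E →L[ℝ] E => (1 + L).det :=
        hcont.comp (continuous_const.add continuous_id)
      have h3 := h2.tendsto 0
      have h4 : ((1 : E →L[ℝ] E) + 0).det = 1 := by
        rw [add_zero]; exact LinearMap.det_id
      rwa [h4] at h3
    obtain ⟨ε, hε, h⟩ := Metric.eventually_nhds_iff.1 (h1.eventually (lt_mem_nhds one_pos))
    exact ⟨ε, hε, fun L hL => h (by simpa using hL)⟩
  -- Nodes `t` this small give `t * K < 1`, so `t • g` is a contraction, and `t * K < ε`, so the
  -- Jacobian is positive. The `+ 1` covers `K = 0`.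
  obtain ⟨v, c, hv, hp⟩ := exists_extrapolation_weights (Module.finrank ℝ E)
    (δ := min 1 ε / (K + 1)) (by positivity)
  have hK : (0 : ℝ) < K + 1 := by positivity
  have hbound : ∀ x, ‖fderiv ℝ g x‖ ≤ K := fun x => norm_fderiv_le_of_lipschitz ℝ hg
  have key : ∀ i ∈ Finset.range (Module.finrank ℝ E + 1),
      IntegrableOn (fun x => (1 + v i • fderiv ℝ g x).det) U μ ∧
      ∫ x in U, (1 + v i • fderiv ℝ g x).det ∂μ = μ.real U := by
    intro i hi
    obtain ⟨hv0, hv1⟩ := hv i hi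
    rw [lt_div_iff₀ hK] at hv1
    have hvK : v i * K < min 1 ε := by nlinarith
    have hcon : ContractingWith (Real.toNNReal (v i) * K) fun x => v i • g x := by
      constructor
      · rw [← NNReal.coe_lt_coe]
        push_cast
        rw [Real.coe_toNNReal _ hv0.le]
        exact hvK.trans_le (min_le_left _ _)
      · refine LipschitzWith.of_dist_le_mul fun a b => ?_
        push_cast
        rw [Real.coe_toNNReal _ hv0.le, dist_smul₀, Real.norm_of_nonneg hv0.le, mul_assoc]
        exact mul_le_mul_of_nonneg_left (hg.dist_le_mul a b) hv0.le
    have hbij := bijective_add_of_contracting hcon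
    have himg := hbij.image_eq_of_eqOn_compl (U := U) fun x hx => by simp [hg0 x hx]
    have hder : ∀ x ∈ U, HasFDerivWithinAt (fun x => x + v i • g x)
        (1 + v i • fderiv ℝ g x) U x := fun x hx =>
      ((hasFDerivAt_id x).add ((hdiff x hx).hasFDerivAt.const_smul (v i))).hasFDerivWithinAt
    have hpos : ∀ x, |(1 + v i • fderiv ℝ g x).det| = (1 + v i • fderiv ℝ g x).det := by
      intro x
      refine abs_of_pos (hdet _ ?_)
      rw [norm_smul, Real.norm_of_nonneg hv0.le]
      exact (mul_le_mul_of_nonneg_left (hbound x) hv0.le).trans_lt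
        (hvK.trans_le (min_le_right _ _))
    have hint := integrableOn_image_iff_integrableOn_abs_det_fderiv_smul μ hU.measurableSet hder
      hbij.1.injOn (fun _ => (1 : ℝ))
    have hval := integral_image_eq_integral_abs_det_fderiv_smul μ hU.measurableSet hder
      hbij.1.injOn (fun _ => (1 : ℝ))
    simp only [himg, hpos, smul_eq_mul, mul_one] at hint hval
    refine ⟨hint.1 (integrableOn_const hbdd.measure_lt_top.ne), ?_⟩
    rw [← hval]
    simp
  have hsum1 : ∑ i ∈ Finset.range (Module.finrank ℝ E + 1), c i = 1 := by
    simpa using (hp 1 (by simp)).symm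
  have hpt : ∀ x ∈ U, (0 : ℝ) = ∑ i ∈ Finset.range (Module.finrank ℝ E + 1),
      c i * (1 + v i • fderiv ℝ g x).det := by
    intro x hx
    obtain ⟨p, hpd, hpe⟩ := (fderiv ℝ g x).exists_polynomial_eval_eq_det_one_add_smul
    have h := hp p hpd
    simp only [hpe, one_smul] at h
    rwa [hzero x hx] at h
  have h0 : (0 : ℝ) = μ.real U := by
    calc (0 : ℝ) = ∫ x in U, (0 : ℝ) ∂μ := by simp
      _ = ∫ x in U, ∑ i ∈ Finset.range (Module.finrank ℝ E + 1),
            c i * (1 + v i • fderiv ℝ g x).det ∂μ :=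
          setIntegral_congr_fun hU.measurableSet hpt
      _ = ∑ i ∈ Finset.range (Module.finrank ℝ E + 1), c i * μ.real U := by
          rw [integral_finsetSum _ fun i hi => (key i hi).1.const_mul (c i)]
          refine Finset.sum_congr rfl fun i hi => ?_
          rw [integral_const_mul, (key i hi).2]
      _ = μ.real U := by rw [← Finset.sum_mul, hsum1, one_mul]
  exact (ENNReal.toReal_pos (hU.measure_pos μ hne).ne' hbdd.measure_lt_top.ne).ne h0

/-! ### Brouwer's fixed point theorem -/

section

variable {E : Type*} [NormedAddCommGroup E] [NormedSpace ℝ E]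

/-- Extension by zero of a Lipschitz map on a closed ball that vanishes on the sphere. -/
theorem LipschitzOnWith.lipschitzWith_indicator_ball {F : Type*} [NormedAddCommGroup F]
    {f : E → F} {K : NNReal} {R : ℝ} (hf : LipschitzOnWith K f (Metric.closedBall 0 R))
    (h0 : ∀ x, ‖x‖ = R → f x = 0) : LipschitzWith K ((Metric.ball (0 : E) R).indicator f) := by
  classical
  have hin : ∀ x, ‖x‖ ≤ R → (Metric.ball (0 : E) R).indicator f x = f x := by
    intro x hx
    rcases hx.lt_or_eq with h | h
    · exact Set.indicator_of_mem (by simpa using h) f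
    · rw [Set.indicator_of_notMem (by simp [h]), h0 x h]
  have hout : ∀ x, R ≤ ‖x‖ → (Metric.ball (0 : E) R).indicator f x = 0 := fun x hx =>
    Set.indicator_of_notMem (by simpa using hx) f
  have hmix : ∀ x y, ‖x‖ ≤ R → R ≤ ‖y‖ →
      dist ((Metric.ball (0 : E) R).indicator f x) ((Metric.ball (0 : E) R).indicator f y) ≤
        K * dist x y := by
    intro x y hx hy
    -- The segment from `x` to `y` meets the sphere, where `f` vanishes, no farther from `x` than
    -- `y` is.
    obtain ⟨t, ht, htR⟩ : R ∈ (fun t : ℝ => ‖AffineMap.lineMap x y t‖) '' Set.Icc 0 1 :=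
      intermediate_value_Icc zero_le_one (by fun_prop) (by simpa using ⟨hx, hy⟩)
    have hz : f (AffineMap.lineMap x y t) = 0 := h0 _ htR
    rw [hin x hx, hout y hy, ← hz]
    refine (hf.dist_le_mul x (by simpa using hx) _ (by simpa using htR.le)).trans ?_
    rw [dist_left_lineMap, Real.norm_of_nonneg ht.1]
    exact mul_le_mul_of_nonneg_left (mul_le_of_le_one_left dist_nonneg ht.2) K.2
  refine LipschitzWith.of_dist_le_mul fun x y => ?_
  rcases le_total ‖x‖ R with hx | hx <;> rcases le_total ‖y‖ R with hy | hy
  · rw [hin x hx, hin y hy]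
    exact hf.dist_le_mul x (by simpa using hx) y (by simpa using hy)
  · exact hmix x y hx hy
  · rw [dist_comm, dist_comm x]
    exact hmix y x hy hx
  · rw [hout x hx, hout y hy, dist_self]
    positivity

end

section

variable {E : Type*} [NormedAddCommGroup E] [InnerProductSpace ℝ E]

/-- The derivative of a map into a sphere of positive radius is singular. -/
theorem HasFDerivAt.det_eq_zero_of_norm_eq [FiniteDimensional ℝ E] {f : E → E} {f' : E →L[ℝ] E}
    {x : E} {R : ℝ} (hf : HasFDerivAt f f' x) (hR : 0 < R) (h : ∀ᶠ y in nhds x, ‖f y‖ = R) :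
    f'.det = 0 := by
  by_contra hdet
  have h1 : HasFDerivAt (fun y => ‖f y‖ ^ 2) (0 : E →L[ℝ] ℝ) x :=
    (hasFDerivAt_const (R ^ 2) x).congr_of_eventuallyEq (h.mono fun y hy => by simp [hy])
  have h2 := hf.norm_sq.unique h1
  have hsurj : Function.Surjective f' :=
    (LinearMap.equivOfDetNeZero (f' : E →ₗ[ℝ] E) hdet).surjective
  -- The derivative of `‖f‖ ^ 2` in this direction is `2 * R ^ 2`, yet it must be zero.
  obtain ⟨u, hu⟩ := hsurj (f x)
  have h3 := congrArg (fun L : E →L[ℝ] ℝ => L u) h2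
  have h4 : ‖f x‖ = R := h.self_of_nhds
  simp [hu, h4, hR.ne'] at h3

/-- A `C¹` vector field that is the identity on a sphere vanishes somewhere in the ball. -/
theorem exists_eq_zero_of_eqOn_sphere [FiniteDimensional ℝ E] {w : E → E} {R : ℝ} (hR : 0 < R)
    (hw : ContDiff ℝ 1 w) (hid : ∀ x, ‖x‖ = R → w x = x) : ∃ x, ‖x‖ ≤ R ∧ w x = 0 := by
  by_contra! hne
  set W : Set E := {x | w x ≠ 0}
  have hWo : IsOpen W := isOpen_ne_fun hw.continuous continuous_const
  have hBW : Metric.closedBall (0 : E) R ⊆ W := fun x hx => hne x (by simpa using hx)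
  set f : E → E := fun x => (R / ‖w x‖) • w x with hf
  set g : E → E := fun x => f x - x with hg
  have hgC : ContDiffOn ℝ 1 g W := by
    intro x hx
    have hwx : ContDiffAt ℝ 1 w x := hw.contDiffAt
    exact (((contDiffAt_const.div (hwx.norm ℝ hx) (norm_ne_zero_iff.2 hx)).smul hwx).sub
      contDiffAt_id).contDiffWithinAt
  have hgd : ∀ x ∈ W, DifferentiableAt ℝ g x := fun x hx =>
    (hgC.contDiffAt (hWo.mem_nhds hx)).differentiableAt one_ne_zero
  obtain ⟨C, hC⟩ := (isCompact_closedBall (0 : E) R).exists_bound_of_continuousOn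
    ((hgC.continuousOn_fderiv_of_isOpen hWo le_rfl).mono hBW)
  have hlip : LipschitzOnWith C.toNNReal g (Metric.closedBall 0 R) :=
    (convex_closedBall 0 R).lipschitzOnWith_of_nnnorm_fderiv_le
      (fun x hx => hgd x (hBW hx))
      (fun x hx => NNReal.le_toNNReal_of_coe_le (hC x hx))
  have hlip' := hlip.lipschitzWith_indicator_ball (fun x hx => by
    simp [hg, hf, hid x hx, hx, hR.ne'])
  have heq : ∀ x ∈ Metric.ball (0 : E) R,
      (Metric.ball (0 : E) R).indicator g =ᶠ[nhds x] g := fun x hx =>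
    Set.EqOn.eventuallyEq_of_mem (fun y hy => Set.indicator_of_mem hy g)
      (Metric.isOpen_ball.mem_nhds hx)
  have hBW' : Metric.ball (0 : E) R ⊆ W := Metric.ball_subset_closedBall.trans hBW
  obtain ⟨x, hx, hdet⟩ := exists_det_one_add_fderiv_ne_zero Metric.isOpen_ball
    (Metric.nonempty_ball.2 hR) Metric.isBounded_ball hlip'
    (fun x hx => Set.indicator_of_notMem hx g)
    (fun x hx => (heq x hx).differentiableAt_iff.2 (hgd x (hBW' hx)))
  rw [(heq x hx).fderiv_eq] at hdet
  have hfd : HasFDerivAt f (1 + fderiv ℝ g x) x := by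
    have h := (hasFDerivAt_id (𝕜 := ℝ) x).add (hgd x (hBW' hx)).hasFDerivAt
    refine h.congr_of_eventuallyEq (Filter.Eventually.of_forall fun y => ?_)
    simp [hg]
  refine hdet (hfd.det_eq_zero_of_norm_eq hR ?_)
  filter_upwards [hWo.mem_nhds (hBW' hx)] with y hy
  have : 0 < ‖w y‖ := norm_pos_iff.2 hy
  simp only [hf]
  rw [norm_smul, Real.norm_of_nonneg (by positivity), div_mul_cancel₀ _ this.ne']

/-- Brouwer's fixed point theorem for bounded continuous self-maps of a Euclidean space. -/
theorem exists_fixedPoint_of_continuous_of_bounded [FiniteDimensional ℝ E] {T : E → E} {M : ℝ}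
    (hT : Continuous T) (hM : ∀ x, ‖T x‖ ≤ M) : ∃ x, T x = x := by
  by_contra! hne
  have hM0 : 0 ≤ M := (norm_nonneg _).trans (hM 0)
  obtain ⟨δ, hδ, hδT⟩ : ∃ δ > 0, ∀ x ∈ Metric.closedBall (0 : E) (M + 1), δ ≤ dist x (T x) := by
    obtain ⟨x₀, -, hx₀⟩ := (isCompact_closedBall (0 : E) (M + 1)).exists_isMinOn
      ⟨0, by simpa using (by positivity : (0 : ℝ) ≤ M + 1)⟩
      (continuous_id.dist hT).continuousOn
    exact ⟨dist x₀ (T x₀), dist_pos.2 (hne x₀).symm, fun x hx => hx₀ hx⟩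
  -- Error below `δ` excludes fixed points of `h` in the ball of radius `M + 1`; error below 1 keeps
  -- its values in that ball.
  obtain ⟨h, hh, hhT, -⟩ := hT.exists_contDiff_approx 1 (ε := fun _ => min δ 1) continuous_const
    (fun _ => lt_min hδ one_pos)
  have hhM : ∀ x, ‖h x‖ < M + 1 := by
    intro x
    have h1 : ‖h x - T x‖ < 1 := by
      rw [← dist_eq_norm]; exact (hhT x).trans_le (min_le_right _ _)
    have h2 : ‖h x‖ ≤ ‖h x - T x‖ + ‖T x‖ := by simpa using norm_add_le (h x - T x) (T x)
    linarith [hM x]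
  -- The cutoff makes `x - b x • h x` the identity on the outer sphere, while its zeros lie where `b
  -- = 1` and so are fixed points of `h`.
  let b : ContDiffBump (0 : E) := ⟨M + 1, M + 2, by positivity, by linarith⟩
  obtain ⟨x, -, hx⟩ := exists_eq_zero_of_eqOn_sphere (w := fun x => x - b x • h x)
    (R := M + 2) (by positivity) (contDiff_id.sub (b.contDiff.smul hh)) (fun x hx => by
      have : b x = 0 := b.zero_of_le_dist (by simp [b, hx])
      simp [this])
  have hx' : x = b x • h x := sub_eq_zero.1 hx
  have hxM : ‖x‖ ≤ M + 1 := by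
    calc ‖x‖ = b x * ‖h x‖ := by
          conv_lhs => rw [hx', norm_smul, Real.norm_of_nonneg b.nonneg]
      _ ≤ 1 * ‖h x‖ := mul_le_mul_of_nonneg_right b.le_one (norm_nonneg _)
      _ ≤ M + 1 := by rw [one_mul]; exact (hhM x).le
  have hb1 : b x = 1 := b.one_of_mem_closedBall (by simpa [b] using hxM)
  rw [hb1, one_smul] at hx'
  have h1 := hδT x (by simpa using hxM)
  have h2 := (hhT x).trans_le (min_le_left _ _)
  rw [← hx'] at h2
  exact absurd h2 h1.not_gt

/-! ### Variational inequalities and equilibria -/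

open scoped RealInnerProductSpace in
/-- Hartman–Stampacchia: a continuous field on a compact convex set solves a variational
inequality. -/
theorem exists_variational_inequality [FiniteDimensional ℝ E] {K : Set E} (hK : IsCompact K)
    (hconv : Convex ℝ K) (hne : K.Nonempty) {Φ : E → E} (hΦ : Continuous Φ) :
    ∃ x ∈ K, ∀ y ∈ K, ⟪Φ x, y - x⟫ ≤ 0 := by
  have hproj : ∀ u : E, ∃ p ∈ K, ∀ y ∈ K, ⟪u - p, y - p⟫ ≤ 0 := by
    intro u
    obtain ⟨p, hp, h⟩ := exists_norm_eq_iInf_of_complete_convex hne hK.isComplete hconv u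
    exact ⟨p, hp, (norm_eq_iInf_iff_real_inner_le_zero hconv hp).1 h⟩
  choose P hPK hP using hproj
  have hlip : LipschitzWith 1 P := by
    refine LipschitzWith.of_dist_le_mul fun u v => ?_
    rw [NNReal.coe_one, one_mul, dist_eq_norm, dist_eq_norm]
    have h1 := hP u (P v) (hPK v)
    have h2 := hP v (P u) (hPK u)
    -- Adding the two obtuse-angle inequalities shows that `P` is nonexpansive.
    have h3 : ‖P u - P v‖ ^ 2 ≤ ⟪u - v, P u - P v⟫ := by
      rw [← real_inner_self_eq_norm_sq]
      simp only [inner_sub_left, inner_sub_right] at *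
      linarith
    have h4 := real_inner_le_norm (u - v) (P u - P v)
    by_contra! hlt
    nlinarith [norm_nonneg (u - v)]
  obtain ⟨M, hM⟩ := hK.isBounded.exists_norm_le
  obtain ⟨x, hx⟩ := exists_fixedPoint_of_continuous_of_bounded (T := fun x => P (x + Φ x))
    (hlip.continuous.comp (continuous_id.add hΦ)) (fun x => hM _ (hPK _))
  have hxK : x ∈ K := hx ▸ hPK _
  refine ⟨x, hxK, fun y hy => ?_⟩
  have h := hP (x + Φ x) y hy
  have hx' : P (x + Φ x) = x := hx
  rwa [hx', add_sub_cancel_left] at h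

end

/-- Every continuous pair of payoff gradients has an equilibrium on a product of compact convex
sets of real vectors. -/
theorem exists_pair_maximizing_dotProduct {ι κ : Type*} [Fintype ι] [Fintype κ]
    {X : Set (ι → ℝ)} {Y : Set (κ → ℝ)} (hX : IsCompact X) (hY : IsCompact Y)
    (hXc : Convex ℝ X) (hYc : Convex ℝ Y) (hXne : X.Nonempty) (hYne : Y.Nonempty)
    {a : (ι → ℝ) → (κ → ℝ) → ι → ℝ} {b : (ι → ℝ) → (κ → ℝ) → κ → ℝ}
    (ha : Continuous fun p : (ι → ℝ) × (κ → ℝ) => a p.1 p.2)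
    (hb : Continuous fun p : (ι → ℝ) × (κ → ℝ) => b p.1 p.2) :
    ∃ x ∈ X, ∃ y ∈ Y, (∀ x' ∈ X, x' ⬝ᵥ a x y ≤ x ⬝ᵥ a x y) ∧
      ∀ y' ∈ Y, y' ⬝ᵥ b x y ≤ y ⬝ᵥ b x y := by
  -- The product of function spaces carries the sup norm; this transport supplies an inner product,
  -- the sum of the two dot products.
  let e : EuclideanSpace ℝ (ι ⊕ κ) ≃L[ℝ] (ι → ℝ) × (κ → ℝ) :=
    (EuclideanSpace.equiv (ι ⊕ κ) ℝ).trans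
      (ContinuousLinearEquiv.sumPiEquivProdPi ℝ ι κ fun _ => ℝ)
  have he : ∀ u v, inner ℝ u v = (e v).1 ⬝ᵥ (e u).1 + (e v).2 ⬝ᵥ (e u).2 := by
    intro u v
    simp only [PiLp.inner_apply, Fintype.sum_sum_type]
    rfl
  obtain ⟨z, hz, hzmax⟩ := exists_variational_inequality (K := e.symm '' (X ×ˢ Y))
    ((hX.prod hY).image e.symm.continuous)
    ((hXc.prod hYc).linear_image (e.symm : _ →ₗ[ℝ] EuclideanSpace ℝ (ι ⊕ κ)))
    ((hXne.prod hYne).image _)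
    (Φ := fun z => e.symm (a (e z).1 (e z).2, b (e z).1 (e z).2))
    (e.symm.continuous.comp ((ha.comp e.continuous).prodMk (hb.comp e.continuous)))
  obtain ⟨⟨x, y⟩, ⟨hx, hy⟩, rfl⟩ := hz
  have key : ∀ x' ∈ X, ∀ y' ∈ Y,
      (x' - x) ⬝ᵥ a x y + (y' - y) ⬝ᵥ b x y ≤ 0 := by
    intro x' hx' y' hy'
    have h := hzmax _ (Set.mem_image_of_mem _ (Set.mk_mem_prod hx' hy'))
    simpa [he] using h
  refine ⟨x, hx, y, hy, fun x' hx' => ?_, fun y' hy' => ?_⟩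
  · have h := key x' hx' y hy
    rw [sub_self, zero_dotProduct, add_zero, sub_dotProduct] at h
    linarith
  · have h := key x hx y' hy'
    rw [sub_self, zero_dotProduct, zero_add, sub_dotProduct] at h
    linarith

/-! ### Feasible strategies and the theorem -/

section

variable {ι : Type*} [Fintype ι]

theorem isCompact_stdSimplex_inter_dotProduct_le (r : ι → ℝ) (c : ℝ) :
    IsCompact {x | x ∈ stdSimplex ℝ ι ∧ r ⬝ᵥ x ≤ c} :=
  (isCompact_stdSimplex ℝ ι).inter_right
    (isClosed_le (continuous_const.dotProduct continuous_id) continuous_const)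

theorem convex_stdSimplex_inter_dotProduct_le (r : ι → ℝ) (c : ℝ) :
    Convex ℝ {x | x ∈ stdSimplex ℝ ι ∧ r ⬝ᵥ x ≤ c} :=
  (convex_stdSimplex ℝ ι).inter
    (convex_halfSpace_le (f := fun x => r ⬝ᵥ x)
      ⟨dotProduct_add r, fun a x => dotProduct_smul a r x⟩ c)

theorem stdSimplex_inter_dotProduct_le_nonempty [Nonempty ι] {r : ι → ℝ} {c : ℝ}
    (h : Finset.univ.inf' Finset.univ_nonempty r ≤ c) :
    {x | x ∈ stdSimplex ℝ ι ∧ r ⬝ᵥ x ≤ c}.Nonempty := by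
  classical
  obtain ⟨i, -, hi⟩ := Finset.exists_mem_eq_inf' Finset.univ_nonempty r
  -- The pure strategy of least weight is feasible.
  exact ⟨Pi.single i 1, single_mem_stdSimplex ℝ i, by simpa [← hi] using h⟩

end

theorem mainTheorem3 {m n : ℕ} [NeZero m] [NeZero n] (G : ConstrainedBimatrixGame m n)
    (hr : Finset.univ.inf' Finset.univ_nonempty G.r ≤ G.rAve)
    (hj : Finset.univ.inf' Finset.univ_nonempty G.j ≤ G.jAve) :
    ∃ (x : Fin m → ℝ) (y : Fin n → ℝ), G.IsNashEquilibrium x y := by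
  obtain ⟨x, hx, y, hy, hxmax, hymax⟩ := exists_pair_maximizing_dotProduct
    (X := G.rowStrategies) (Y := G.colStrategies)
    (isCompact_stdSimplex_inter_dotProduct_le G.r G.rAve)
    (isCompact_stdSimplex_inter_dotProduct_le G.j G.jAve)
    (convex_stdSimplex_inter_dotProduct_le G.r G.rAve)
    (convex_stdSimplex_inter_dotProduct_le G.j G.jAve)
    (stdSimplex_inter_dotProduct_le_nonempty hr) (stdSimplex_inter_dotProduct_le_nonempty hj)
    (a := fun _ y => G.A *ᵥ y) (b := fun x _ => x ᵥ* G.B)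
    (continuous_const.matrix_mulVec continuous_snd)
    (continuous_fst.matrix_vecMul continuous_const)
  refine ⟨x, y, hx, hy, hxmax, fun y' hy' => ?_⟩
  simp only [ConstrainedBimatrixGame.colPayoff, Matrix.dotProduct_mulVec]
  rw [dotProduct_comm _ y', dotProduct_comm _ y]
  exact hymax y' hy'
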